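/- **Model.** A sporadic task system has tasks $\tau_1,\dots,\tau_N$; task $\tau_i$ has worst-case execution time $C_i>0$, relative deadline $D_i>0$ and minimum inter-arrival time $T_i>0$, with $C_i\le D_i$ and $C_i\le T_i$; there is no relation between $D_i$ and $T_i$. Consecutive jobs of $\tau_i$ arrive at least $T_i$ time units apart, the first one not before time $0$, and each job needs at most $C_i$ units of execution. The tasks are executed by preemptive global fixed-priority scheduling on $M\ge 2$ identical unit-speed processors, $\tau_i$ having higher priority than $\tau_j$ iff $i<j$: at every instant the $M$ highest-priority tasks with unfinished arrived jobs (all of them, if there are fewer than $M$) are executed, each on one processor; jobs may migrate; at most one job of a task is executed at any time, and the jobs of a task are executed in the order of their arrival. Task $\tau_k$ is *schedulable* if, for every legal sequence of jobs and every such schedule, every job of $\tau_k$ arriving at time $t$ finishes no later than $t+D_k$. Put $U_i=C_i/T_i$, $\delta_k=C_k/\min\{D_k,T_k\}$ and $U^{\max}_{\delta,k}=\max\{\max_{1\le i<k}U_i,\ \delta_k\}$ (which is $\delta_1$ for $k=1$). **Theorem 4.7.** Let $M\ge 2$ and $1\le k\le N$. Task $\tau_k$ is schedulable by the given global fixed-priority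 scheduling if $$\delta_k+\sum_{i=1}^{k-1}\left(\frac{C_i-C_iU_i}{D_k}+U_i\right)\le M-(M-1)\,U^{\max}_{\delta,k}.$$ Moreover, this condition can be tested in linear time: there are a fixed program of a unit-cost real RAM (arithmetic operations and comparisons of real numbers at unit cost) and a constant $c$ such that for all $M$, all task systems and all $k$ the program, given $k$, $M$ and the numbers $C_i,D_i,T_i$, decides within $c\,k$ steps whether the inequality holds. -/

import Mathlib

open MeasureTheory

noncomputable section

/-! ### Sporadic task systems -/

/-- An arbitrary-deadline sporadic task system with `N` tasks. Task `i` has worst-case execution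
time `C i`, relative deadline `D i` and minimum inter-arrival time `T i`. Priorities are unique and
given by the index: task `i` has higher priority than task `j` iff `i < j`. -/
structure TaskSystem (N : ℕ) where
  C : Fin N → ℝ
  D : Fin N → ℝ
  T : Fin N → ℝ
  C_pos : ∀ i, 0 < C i
  D_pos : ∀ i, 0 < D i
  T_pos : ∀ i, 0 < T i
  C_div_D_le_one : ∀ i, C i / D i ≤ 1
  C_div_T_le_one : ∀ i, C i / T i ≤ 1

namespace TaskSystem

variable {N : ℕ}

/-- The utilization `U i = C i / T i`. -/
def util (τ : TaskSystem N) (i : Fin N) : ℝ := τ.C i / τ.T i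

/-- The density `δ i = C i / min {D i, T i}`. -/
def density (τ : TaskSystem N) (i : Fin N) : ℝ := τ.C i / min (τ.D i) (τ.T i)

/-- `max {max_{i < k} U i, δ k}`; this is `δ k` if there is no task `i < k`. -/
def maxUtilDensity (τ : TaskSystem N) (k : Fin N) : ℝ :=
  (Finset.Iio k).fold max (τ.density k) τ.util

/-- The condition of the linear-time test for task `k` on `M` processors. -/
def PassesTest (τ : TaskSystem N) (M : ℕ) (k : Fin N) : Prop :=
  τ.density k + ∑ i ∈ Finset.Iio k, ((τ.C i - τ.C i * τ.util i) / τ.D k + τ.util i)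
    ≤ (M : ℝ) - ((M : ℝ) - 1) * τ.maxUtilDensity k

end TaskSystem

/-- A legal job sequence of a task system: job `j` of task `i` arrives at `arrival i j ≥ 0`, needs
`exec i j ≤ C i` units of execution, and consecutive jobs of task `i` arrive at least `T i`
apart. -/
structure JobSequence {N : ℕ} (τ : TaskSystem N) where
  arrival : Fin N → ℕ → ℝ
  exec : Fin N → ℕ → ℝ
  arrival_nonneg : ∀ i, 0 ≤ arrival i 0
  arrival_add_le : ∀ i j, arrival i j + τ.T i ≤ arrival i (j + 1)
  exec_nonneg : ∀ i j, 0 ≤ exec i j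
  exec_le : ∀ i j, exec i j ≤ τ.C i

/-! ### Schedules on `M` identical processors -/

/-- `σ p t` is the job executed on processor `p` at time `t` (`none` if `p` is idle); the pair
`(i, j)` stands for job `j` of task `i`. Jobs may be preempted and may migrate at any time. -/
abbrev Schedule (M N : ℕ) : Type := Fin M → ℝ → Option (Fin N × ℕ)

namespace Schedule

variable {M N : ℕ}

/-- The set of times at which job `J` is executed on some processor. -/
def runSet (σ : Schedule M N) (J : Fin N × ℕ) : Set ℝ := {t | ∃ p, σ p t = some J}

/-- The amount of time for which job `J` is executed during `[0, t)`. -/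
def service (σ : Schedule M N) (J : Fin N × ℕ) (t : ℝ) : ℝ :=
  volume.real (Set.Ico 0 t ∩ σ.runSet J)

/-- Job `j` of task `i` has arrived before or at time `t` and has not finished yet at time `t`. -/
def Pending (σ : Schedule M N) {τ : TaskSystem N} (ω : JobSequence τ) (i : Fin N) (j : ℕ)
    (t : ℝ) : Prop :=
  ω.arrival i j ≤ t ∧ σ.service (i, j) t < ω.exec i j

/-- Task `i` is active at time `t`: at least one of its jobs has arrived and has not finished. -/
def Active (σ : Schedule M N) {τ : TaskSystem N} (ω : JobSequence τ) (i : Fin N) (t : ℝ) : Prop :=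
  ∃ j, σ.Pending ω i j t

/-- `σ` is a preemptive global fixed-priority schedule of the job sequence `ω`: at every instant
the `M` highest-priority active tasks (or all active tasks, if there are fewer than `M`) are
executed, each of them on one processor, with its jobs in the order of their arrival. -/
structure IsGlobalFP (σ : Schedule M N) {τ : TaskSystem N} (ω : JobSequence τ) : Prop where
  measurableSet_runSet : ∀ J, MeasurableSet (σ.runSet J)
  /-- Only jobs that have arrived and are not finished are executed. -/
  pending : ∀ p t i j, σ p t = some (i, j) → σ.Pending ω i j t
  /-- No intra-task parallelism: a task occupies at most one processor at a time. -/
  sequential : ∀ p q t i j j', σ p t = some (i, j) → σ q t = some (i, j') → p = q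
  /-- Jobs of the same task are executed first-come first-served. -/
  fifo : ∀ p t i j, σ p t = some (i, j) → ∀ j' < j, ¬ σ.Pending ω i j' t
  /-- An active task is not executed only if all processors execute higher-priority tasks. -/
  priority : ∀ t i, σ.Active ω i t → (∀ p j, σ p t ≠ some (i, j)) →
    ∀ p, ∃ i' j', i' < i ∧ σ p t = some (i', j')

end Schedule

/-- Task `k` is schedulable by preemptive global fixed-priority scheduling on `M` processors: in
every global fixed-priority schedule of every legal job sequence, every job of task `k` finishes
no later than its absolute deadline. -/
def TaskSystem.Schedulable {N : ℕ} (τ : TaskSystem N) (M : ℕ) (k : Fin N) : Prop :=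
  ∀ (ω : JobSequence τ) (σ : Schedule M N), σ.IsGlobalFP ω →
    ∀ j, ω.exec k j ≤ σ.service (k, j) (ω.arrival k j + τ.D k)

/-! ### The unit-cost real RAM -/

namespace RealRAM

/-- The arithmetic operations on real registers. -/
inductive Op
  | add | sub | mul | div

/-- Semantics of the arithmetic operations (division by zero returns zero). -/
def Op.eval : Op → ℝ → ℝ → ℝ
  | .add, x, y => x + y
  | .sub, x, y => x - y
  | .mul, x, y => x * y
  | .div, x, y => x / y

/-- Instructions. There are real registers, index registers holding natural numbers, and a memory
of real numbers which is addressed through the index registers. -/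
inductive Instr
  /-- real register `d` := the natural number `n` -/
  | const (d n : ℕ)
  /-- real register `d` := (real register `a`) `o` (real register `b`) -/
  | arith (o : Op) (d a b : ℕ)
  /-- real register `d` := memory cell addressed by index register `i` -/
  | load (d i : ℕ)
  /-- memory cell addressed by index register `i` := real register `a` -/
  | store (i a : ℕ)
  /-- index register `d` := `n` -/
  | iconst (d n : ℕ)
  /-- index register `d` := (index register `a`) + (index register `b`) -/
  | iadd (d a b : ℕ)
  /-- jump to `l` if (real register `a`) ≤ (real register `b`) -/
  | jle (a b l : ℕ)
  /-- jump to `l` if (index register `a`) ≤ (index register `b`) -/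
  | ijle (a b l : ℕ)
  /-- halt with the given answer -/
  | halt (answer : Bool)

/-- A program is a finite list of instructions. -/
abbrev Program : Type := List Instr

/-- Configurations; `out = some b` means that the machine has halted with answer `b`. -/
structure Config where
  pc : ℕ
  reg : ℕ → ℝ
  idx : ℕ → ℕ
  mem : ℕ → ℝ
  out : Option Bool

/-- Execution of one instruction. -/
def Instr.exec (s : Config) : Instr → Config
  | .const d n => { s with pc := s.pc + 1, reg := Function.update s.reg d (n : ℝ) }
  | .arith o d a b =>
      { s with pc := s.pc + 1, reg := Function.update s.reg d (o.eval (s.reg a) (s.reg b)) }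
  | .load d i => { s with pc := s.pc + 1, reg := Function.update s.reg d (s.mem (s.idx i)) }
  | .store i a => { s with pc := s.pc + 1, mem := Function.update s.mem (s.idx i) (s.reg a) }
  | .iconst d n => { s with pc := s.pc + 1, idx := Function.update s.idx d n }
  | .iadd d a b => { s with pc := s.pc + 1, idx := Function.update s.idx d (s.idx a + s.idx b) }
  | .jle a b l => open Classical in
      { s with pc := if s.reg a ≤ s.reg b then l else s.pc + 1 }
  | .ijle a b l => { s with pc := if s.idx a ≤ s.idx b then l else s.pc + 1 }
  | .halt b => { s with out := some b }

/-- One step of the machine. A halted machine stays as it is; a machine whose program counter has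
left the program is stuck without an answer. -/
def step (P : Program) (s : Config) : Config :=
  match s.out with
  | some _ => s
  | none =>
    match P[s.pc]? with
    | some ins => ins.exec s
    | none => s

/-- The initial configuration with natural-number input `n` (in index register `0`) and
real-number input `x` (in the memory). All other registers are `0`. -/
def init (n : ℕ) (x : ℕ → ℝ) : Config where
  pc := 0
  reg := fun _ => 0
  idx := fun i => if i = 0 then n else 0
  mem := x
  out := none

/-- On input `n`, `x` the program `P` halts within `t` steps, and its answer is `true` iff `A`
holds. -/
def DecidesWithin (P : Program) (n : ℕ) (x : ℕ → ℝ) (t : ℕ) (A : Prop) : Prop :=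
  ∃ s ≤ t, ∃ b : Bool, ((step P)^[s] (init n x)).out = some b ∧ (b = true ↔ A)

end RealRAM

/-- The parameters of a scheduling problem as the memory of a real RAM: cell `0` holds the number
`M` of processors, and cells `3i+1`, `3i+2`, `3i+3` hold `C i`, `D i`, `T i`. -/
def TaskSystem.input {N : ℕ} (τ : TaskSystem N) (M : ℕ) : ℕ → ℝ
  | 0 => (M : ℝ)
  | a + 1 =>
    if h : a / 3 < N then
      if a % 3 = 0 then τ.C ⟨a / 3, h⟩
      else if a % 3 = 1 then τ.D ⟨a / 3, h⟩
      else τ.T ⟨a / 3, h⟩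
    else 0

end

/-! ### Length of the part of a set inside an interval -/

/-! Sufficiency is proved by contradiction. Let a job of task `k` miss its deadline `e`, and go back
to a clean time `s`, not after its arrival, such that task `k` is active throughout `[s, e)`. Its
density bounds its execution there strictly by `δ_k (e - s)` (`Clean.occupancy_lt_of_miss`), and
whenever it waits, all `M` processors serve higher priorities (`IsGlobalFP.le_sum_occupancy`). Hence
task `k` and the tasks above it together execute at average rate at least `μ = M - (M - 1) ρ` on
`[s, e)`, where `ρ` is the maximum in the test.

The window is extended back to a point `t₀` of `[0, s]` minimizing the higher-priority work done up
to `t` minus `μ t`. That work then has average rate at least `μ` on `[t₀, s)`, but at most `μ` on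
every `[r, t₀)` with `r ≥ 0`. The second fact controls carry-in: if a task `i < k` has been active
since a clean time `r`, running for less than `ρ (t₀ - r)` would keep all processors busy long
enough to exceed rate `μ`. So it has already executed `U_i (t₀ - r)`; subtracting this from the
bound of `Clean.occupancy_le` on `[r, e)` leaves `U_i (e - t₀) + C_i (1 - U_i)`, as if `t₀` were
clean. Summing over `i` and using `e - t₀ ≥ D_k` contradicts the test.

For the running time, one pass over the tasks accumulates the two sums and the maximum; the
remaining work is constant. -/

/-- The length of the part of `R` that lies in `[s, e)`. -/
noncomputable def occupancy (R : Set ℝ) (s e : ℝ) : ℝ := volume.real (Set.Ico s e ∩ R)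

theorem volume_Ico_inter_ne_top (R : Set ℝ) (s e : ℝ) : volume (Set.Ico s e ∩ R) ≠ ⊤ :=
  ((measure_mono Set.inter_subset_left).trans_lt measure_Ico_lt_top).ne

theorem occupancy_nonneg (R : Set ℝ) (s e : ℝ) : 0 ≤ occupancy R s e := measureReal_nonneg

theorem occupancy_le_length (R : Set ℝ) {s e : ℝ} (h : s ≤ e) : occupancy R s e ≤ e - s := by
  have := measureReal_mono (μ := volume) (Set.inter_subset_left (s := Set.Ico s e) (t := R))
    measure_Ico_lt_top.ne
  simpa [occupancy, Real.volume_real_Ico_of_le h] using this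

theorem occupancy_add {R : Set ℝ} (hR : MeasurableSet R) {r s e : ℝ} (h₁ : r ≤ s) (h₂ : s ≤ e) :
    occupancy R r e = occupancy R r s + occupancy R s e := by
  unfold occupancy
  rw [← measureReal_union _ (measurableSet_Ico.inter hR) (volume_Ico_inter_ne_top R r s)
    (volume_Ico_inter_ne_top R s e), ← Set.union_inter_distrib_right,
    Set.Ico_union_Ico_eq_Ico h₁ h₂]
  exact (Set.Ico_disjoint_Ico_same).mono Set.inter_subset_left Set.inter_subset_left

theorem occupancy_eq_zero {R : Set ℝ} {s e : ℝ} (h : ∀ t ∈ Set.Ico s e, t ∉ R) :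
    occupancy R s e = 0 := by
  have : Set.Ico s e ∩ R = ∅ := by
    ext t; simpa using fun h₁ h₂ => h t ⟨h₁, h₂⟩
  simp [occupancy, this]

theorem occupancy_biUnion_le {ι : Type*} (F : Finset ι) {R : Set ℝ} (Q : ι → Set ℝ) {s e : ℝ}
    (h : ∀ t ∈ Set.Ico s e, t ∈ R → ∃ j ∈ F, t ∈ Q j) :
    occupancy R s e ≤ ∑ j ∈ F, occupancy (Q j) s e := by
  unfold occupancy
  refine le_trans (measureReal_mono (s₂ := ⋃ j ∈ F, Set.Ico s e ∩ Q j) ?_ ?_)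
    (measureReal_biUnion_finset_le F _)
  · rintro t ⟨h₁, h₂⟩
    obtain ⟨j, hj, hq⟩ := h t h₁ h₂
    simp only [Set.mem_iUnion]
    exact ⟨j, hj, h₁, hq⟩
  · refine ((measure_mono (t := Set.Ico s e) ?_).trans_lt measure_Ico_lt_top).ne
    exact Set.iUnion₂_subset fun j _ => Set.inter_subset_left

theorem occupancy_mono_left {R : Set ℝ} {r s e : ℝ} (h₁ : r ≤ s) :
    occupancy R s e ≤ occupancy R r e :=
  measureReal_mono (Set.inter_subset_inter_left _ (Set.Ico_subset_Ico_left h₁))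
    (volume_Ico_inter_ne_top R r e)

theorem occupancy_mono_right {R : Set ℝ} {r s e : ℝ} (h₁ : s ≤ e) :
    occupancy R r s ≤ occupancy R r e :=
  measureReal_mono (Set.inter_subset_inter_left _ (Set.Ico_subset_Ico_right h₁))
    (volume_Ico_inter_ne_top R r e)

/-- Service accrues at rate at most one, so it is 1-Lipschitz. Continuity serves an intermediate
value argument and the choice of a minimizer. -/
theorem continuousOn_occupancy (R : Set ℝ) (hR : MeasurableSet R) :
    ContinuousOn (occupancy R 0) (Set.Ici 0) := by
  refine LipschitzOnWith.continuousOn (K := 1) (LipschitzOnWith.of_le_add ?_)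
  intro x hx y hy
  rcases le_total x y with h | h
  · exact (occupancy_mono_right h).trans (by simp [dist_nonneg])
  · rw [occupancy_add hR hy h, Real.dist_eq, abs_of_nonneg (sub_nonneg.2 h)]
    linarith [occupancy_le_length R h]

/-- Lets a pointwise count of busy processors be integrated into an inequality between occupancies.
-/
theorem occupancy_eq_integral {R : Set ℝ} (hR : MeasurableSet R) (s e : ℝ) :
    occupancy R s e = ∫ t in Set.Ico s e, R.indicator (fun _ => (1 : ℝ)) t := by
  rw [integral_indicator hR, Measure.restrict_restrict hR, Set.inter_comm]
  simp [occupancy]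

/-! ### Service of single jobs and clean times -/

namespace Schedule

variable {M N : ℕ} {σ : Schedule M N} {τ : TaskSystem N} {ω : JobSequence τ}

/-- The set of times at which some job of task `i` is executed. -/
def taskRunSet (σ : Schedule M N) (i : Fin N) : Set ℝ := ⋃ j, σ.runSet (i, j)

theorem service_eq_occupancy (σ : Schedule M N) (J : Fin N × ℕ) (t : ℝ) :
    σ.service J t = occupancy (σ.runSet J) 0 t := rfl

theorem service_mono (σ : Schedule M N) (J : Fin N × ℕ) : Monotone (σ.service J) :=
  fun _ _ h => occupancy_mono_right h

theorem IsGlobalFP.measurableSet_taskRunSet (h : σ.IsGlobalFP ω) (i : Fin N) :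
    MeasurableSet (σ.taskRunSet i) :=
  MeasurableSet.iUnion fun _ => h.measurableSet_runSet _

theorem arrival_add_mul_le (ω : JobSequence τ) (i : Fin N) {j j' : ℕ} (h : j ≤ j') :
    ω.arrival i j + ((j' : ℝ) - j) * τ.T i ≤ ω.arrival i j' := by
  induction j', h using Nat.le_induction with
  | base => simp
  | succ n _ ih => have := ω.arrival_add_le i n; push_cast; linarith

theorem arrival_strictMono (ω : JobSequence τ) (i : Fin N) : StrictMono (ω.arrival i) :=
  strictMono_nat_of_lt_succ fun j => by linarith [ω.arrival_add_le i j, τ.T_pos i]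

theorem zero_le_arrival (ω : JobSequence τ) (i : Fin N) (j : ℕ) : 0 ≤ ω.arrival i j :=
  (ω.arrival_nonneg i).trans ((arrival_strictMono ω i).monotone (Nat.zero_le j))

theorem exists_lt_arrival (ω : JobSequence τ) (i : Fin N) (t : ℝ) : ∃ j, t < ω.arrival i j := by
  obtain ⟨n, hn⟩ := exists_nat_gt (t / τ.T i)
  refine ⟨n, ?_⟩
  have h := arrival_add_mul_le ω i (Nat.zero_le n)
  have := ω.arrival_nonneg i
  rw [div_lt_iff₀ (τ.T_pos i)] at hn
  simp only [Nat.cast_zero, sub_zero] at h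
  linarith

theorem IsGlobalFP.pending_of_mem (h : σ.IsGlobalFP ω) {i : Fin N} {j : ℕ} {t : ℝ}
    (ht : t ∈ σ.runSet (i, j)) : σ.Pending ω i j t := by
  obtain ⟨p, hp⟩ := ht
  exact h.pending p t i j hp

/-- A job never receives more service than it requires. -/
theorem IsGlobalFP.service_le_exec (h : σ.IsGlobalFP ω) (i : Fin N) (j : ℕ) (t : ℝ) :
    σ.service (i, j) t ≤ ω.exec i j := by
  by_contra! hlt
  have ht : 0 ≤ t := by
    by_contra! ht
    have : σ.service (i, j) t = 0 := by simp [service, Set.Ico_eq_empty (not_lt.2 ht.le)]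
    linarith [ω.exec_nonneg i j]
  have h0 : σ.service (i, j) 0 = 0 := by simp [service]
  -- At `s` the job has received exactly its requirement; it is never pending afterwards, so its
  -- service cannot grow.
  obtain ⟨s, hs, hse⟩ := intermediate_value_Icc ht
    ((continuousOn_occupancy _ (h.measurableSet_runSet (i, j))).mono Set.Icc_subset_Ici_self)
    ⟨by rw [← service_eq_occupancy, h0]; exact ω.exec_nonneg i j, hlt.le⟩
  have hz : occupancy (σ.runSet (i, j)) s t = 0 := occupancy_eq_zero fun x hx hmem => by
    have h1 := (h.pending_of_mem hmem).2
    have h2 := σ.service_mono (i, j) hx.1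
    rw [service_eq_occupancy _ _ s] at h2
    linarith
  have := occupancy_add (h.measurableSet_runSet (i, j)) hs.1 hs.2
  rw [service_eq_occupancy] at hlt
  linarith

theorem IsGlobalFP.occupancy_runSet_le (h : σ.IsGlobalFP ω) (i : Fin N) (j : ℕ) {s : ℝ}
    (hs : 0 ≤ s) (e : ℝ) : occupancy (σ.runSet (i, j)) s e ≤ ω.exec i j :=
  (occupancy_mono_left hs).trans (h.service_le_exec i j e)

/-- No job of task `i` that arrives before time `s` is unfinished at time `s`. -/
def Clean (σ : Schedule M N) {τ : TaskSystem N} (ω : JobSequence τ) (i : Fin N) (s : ℝ) : Prop :=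
  ∀ j, ω.arrival i j < s → ¬ σ.Pending ω i j s

/-- After a clean time `s`, no job that arrived before `s` is executed. -/
theorem Clean.le_arrival (h : σ.IsGlobalFP ω) {i : Fin N} {s t : ℝ} (hs : σ.Clean ω i s)
    (hst : s ≤ t) {j : ℕ} (ht : t ∈ σ.runSet (i, j)) : s ≤ ω.arrival i j := by
  by_contra! hlt
  refine hs j hlt ⟨hlt.le, ?_⟩
  exact (σ.service_mono (i, j) hst).trans_lt (h.pending_of_mem ht).2

/-- Every time `t` is reached from a clean time through an interval in which the task is
active. -/
theorem exists_clean (σ : Schedule M N) (ω : JobSequence τ) (i : Fin N) {t : ℝ} (ht : 0 ≤ t) :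
    ∃ s, 0 ≤ s ∧ s ≤ t ∧ σ.Clean ω i s ∧ ∀ x ∈ Set.Ico s t, σ.Active ω i x := by
  classical
  by_cases hact : ∃ j, σ.Pending ω i j t
  swap
  · exact ⟨t, ht, le_rfl, fun j _ hj => hact ⟨j, hj⟩, fun x hx => absurd hx.1 (not_le.2 hx.2)⟩
  obtain ⟨j, hj⟩ := hact
  -- The clean time is the last clean arrival among jobs `0, …, j`; job `0` qualifies because
  -- nothing precedes it.
  let P : ℕ → Prop := fun m => σ.Clean ω i (ω.arrival i m)
  have hP0 : P 0 := fun m hm _ =>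
    absurd ((arrival_strictMono ω i).monotone (Nat.zero_le m)) (not_le.2 hm)
  set m₀ := Nat.findGreatest P j with hm₀
  have hm₀j : m₀ ≤ j := Nat.findGreatest_le j
  refine ⟨ω.arrival i m₀, zero_le_arrival ω i m₀,
    ((arrival_strictMono ω i).monotone hm₀j).trans hj.1,
    Nat.findGreatest_spec (P := P) (Nat.zero_le j) hP0, fun x hx => ?_⟩
  by_cases hxj : ω.arrival i j ≤ x
  · exact ⟨j, hxj, (σ.service_mono (i, j) hx.2.le).trans_lt hj.2⟩
  -- The first arrival after `x` is not clean, since it comes after `m₀`. A job pending there has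
  -- arrived by `x`, and is therefore pending at `x` too.
  have hex : ∃ m, x < ω.arrival i m := ⟨j, not_le.1 hxj⟩
  have hxm := Nat.find_spec hex
  set m := Nat.find hex with hm
  have hmj : m ≤ j := Nat.find_min' hex (not_le.1 hxj)
  have hlt : m₀ < m := (arrival_strictMono ω i).lt_iff_lt.1 (hx.1.trans_lt hxm)
  have hnP : ¬ P m := Nat.findGreatest_is_greatest hlt hmj
  simp only [P, Clean, not_forall, not_not] at hnP
  obtain ⟨m', hm', hpend⟩ := hnP
  have hm'm : m' < m := (arrival_strictMono ω i).lt_iff_lt.1 hm'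
  exact ⟨m', not_lt.1 (Nat.find_min hex hm'm),
    (σ.service_mono (i, m') hxm.le).trans_lt hpend.2⟩

end Schedule

/-! ### Utilization and density -/

namespace TaskSystem

variable {N : ℕ} (τ : TaskSystem N)

theorem util_nonneg (i : Fin N) : 0 ≤ τ.util i := (div_pos (τ.C_pos i) (τ.T_pos i)).le

theorem util_le_one (i : Fin N) : τ.util i ≤ 1 := τ.C_div_T_le_one i

theorem util_mul_period (i : Fin N) : τ.util i * τ.T i = τ.C i :=
  div_mul_cancel₀ _ (τ.T_pos i).ne'

theorem density_pos (k : Fin N) : 0 < τ.density k :=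
  div_pos (τ.C_pos k) (lt_min (τ.D_pos k) (τ.T_pos k))

theorem le_density_mul_deadline (k : Fin N) : τ.C k ≤ τ.density k * τ.D k := by
  have h := lt_min (τ.D_pos k) (τ.T_pos k)
  calc τ.C k = τ.density k * min (τ.D k) (τ.T k) := (div_mul_cancel₀ _ h.ne').symm
    _ ≤ _ := mul_le_mul_of_nonneg_left (min_le_left _ _) (τ.density_pos k).le

theorem le_density_mul_period (k : Fin N) : τ.C k ≤ τ.density k * τ.T k := by
  have h := lt_min (τ.D_pos k) (τ.T_pos k)
  calc τ.C k = τ.density k * min (τ.D k) (τ.T k) := (div_mul_cancel₀ _ h.ne').symm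
    _ ≤ _ := mul_le_mul_of_nonneg_left (min_le_right _ _) (τ.density_pos k).le

theorem density_le_maxUtilDensity (k : Fin N) : τ.density k ≤ τ.maxUtilDensity k :=
  (Finset.le_fold_max _).2 (Or.inl le_rfl)

theorem util_le_maxUtilDensity {i k : Fin N} (h : i < k) : τ.util i ≤ τ.maxUtilDensity k :=
  (Finset.le_fold_max _).2 (Or.inr ⟨i, Finset.mem_Iio.2 h, le_rfl⟩)

end TaskSystem

/-! ### Bounds on the execution of a task -/

namespace Schedule

variable {M N : ℕ} {σ : Schedule M N} {τ : TaskSystem N} {ω : JobSequence τ}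

/-- The execution of a task after a clean time is bounded by its utilization and one job. -/
theorem Clean.occupancy_le (h : σ.IsGlobalFP ω) {i : Fin N} {s e : ℝ} (hs : σ.Clean ω i s)
    (h0 : 0 ≤ s) (hse : s ≤ e) :
    occupancy (σ.taskRunSet i) s e
      ≤ τ.util i * (e - s) + τ.C i * (1 - τ.util i) := by
  classical
  have hU0 := τ.util_nonneg i
  have hU1 := τ.util_le_one i
  have hC := τ.C_pos i
  have hmono := arrival_strictMono ω i
  have hexs : ∃ j, s ≤ ω.arrival i j := (exists_lt_arrival ω i s).imp fun _ => le_of_lt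
  have hexe : ∃ j, e ≤ ω.arrival i j := (exists_lt_arrival ω i e).imp fun _ => le_of_lt
  -- Only the jobs `a, …, b - 1`, which arrive in `[s, e)`, can run there.
  set a := Nat.find hexs with ha
  set b := Nat.find hexe with hb
  have has := Nat.find_spec hexs
  rw [← ha] at has
  have hcover : ∀ t ∈ Set.Ico s e, t ∈ σ.taskRunSet i →
      ∃ j ∈ Finset.Ico a b, t ∈ σ.runSet (i, j) := by
    intro t ht hrun
    obtain ⟨j, hj⟩ := Set.mem_iUnion.1 hrun
    refine ⟨j, Finset.mem_Ico.2 ⟨Nat.find_min' hexs (hs.le_arrival h ht.1 hj), ?_⟩, hj⟩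
    have h1 := (h.pending_of_mem hj).1
    exact hmono.lt_iff_lt.1 ((h1.trans_lt ht.2).trans_le (Nat.find_spec hexe))
  have hle := occupancy_biUnion_le _ _ hcover
  have hnn : 0 ≤ τ.util i * (e - s) + τ.C i * (1 - τ.util i) :=
    add_nonneg (mul_nonneg hU0 (by linarith)) (mul_nonneg hC.le (by linarith))
  rcases le_or_gt b a with hba | hab
  · rw [Finset.Ico_eq_empty (not_lt.2 hba), Finset.sum_empty] at hle
    linarith
  obtain ⟨n, hn⟩ : ∃ n, b = n + 1 := ⟨b - 1, by omega⟩
  have han : a ≤ n := by omega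
  have hne : ω.arrival i n < e := not_le.1 (Nat.find_min hexe (by omega))
  rw [hn, Finset.sum_Ico_succ_top han] at hle
  have h1 : ∑ j ∈ Finset.Ico a n, occupancy (σ.runSet (i, j)) s e ≤ ((n : ℝ) - a) * τ.C i := by
    refine (Finset.sum_le_card_nsmul _ _ (τ.C i) fun j _ =>
      (h.occupancy_runSet_le i j h0 e).trans (ω.exec_le i j)).trans ?_
    simp [Nat.cast_sub han]
  have h2 : occupancy (σ.runSet (i, n)) s e ≤ τ.C i :=
    (h.occupancy_runSet_le i n h0 e).trans (ω.exec_le i n)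
  have h3 : occupancy (σ.runSet (i, n)) s e ≤ e - ω.arrival i n := by
    have hsn : s ≤ ω.arrival i n := has.trans (hmono.monotone han)
    rw [occupancy_add (h.measurableSet_runSet _) hsn hne.le, occupancy_eq_zero (e := ω.arrival i n)
      fun t ht hrun => absurd (h.pending_of_mem hrun).1 (not_le.2 ht.2)]
    linarith [occupancy_le_length (σ.runSet (i, n)) hne.le]
  have h4 := arrival_add_mul_le ω i han
  have h5 : ((n : ℝ) - a) * τ.C i ≤ τ.util i * (ω.arrival i n - s) := by
    rw [← τ.util_mul_period i]
    nlinarith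
  -- The last job is bounded by both `e - ω.arrival i n` and `C i`; weighting these bounds by `U i`
  -- and `1 - U i` gives the claim.
  nlinarith [mul_le_mul_of_nonneg_left h3 hU0, mul_le_mul_of_nonneg_left h2 (sub_nonneg.2 hU1)]

/-- If a job of task `k` misses its deadline, the execution of the task since a clean time before
the arrival of this job is less than its density. -/
theorem Clean.occupancy_lt_of_miss (h : σ.IsGlobalFP ω) {k : Fin N} {s : ℝ} (hs : σ.Clean ω k s)
    (h0 : 0 ≤ s) {j : ℕ} (hsj : s ≤ ω.arrival k j)
    (hmiss : σ.service (k, j) (ω.arrival k j + τ.D k) < ω.exec k j) :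
    occupancy (σ.taskRunSet k) s (ω.arrival k j + τ.D k)
      < τ.density k * (ω.arrival k j + τ.D k - s) := by
  classical
  have hmono := arrival_strictMono ω k
  have hexs : ∃ j, s ≤ ω.arrival k j := ⟨j, hsj⟩
  set a := Nat.find hexs with ha
  have has := Nat.find_spec hexs
  rw [← ha] at has
  have haj : a ≤ j := Nat.find_min' hexs hsj
  set e := ω.arrival k j + τ.D k with he
  have hcover : ∀ t ∈ Set.Ico s e, t ∈ σ.taskRunSet k →
      ∃ m ∈ Finset.Ico a (j + 1), t ∈ σ.runSet (k, m) := by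
    intro t ht hrun
    obtain ⟨m, hm⟩ := Set.mem_iUnion.1 hrun
    refine ⟨m, Finset.mem_Ico.2 ⟨Nat.find_min' hexs (hs.le_arrival h ht.1 hm), ?_⟩, hm⟩
    -- Job `j` is unfinished throughout the window, so by FIFO no later job can run in it.
    by_contra! hjm
    obtain ⟨p, hp⟩ := hm
    refine h.fifo p t k m hp j (by omega) ⟨?_, (σ.service_mono (k, j) ht.2.le).trans_lt hmiss⟩
    exact (hmono.monotone (by omega)).trans (h.pending p t k m hp).1
  have hle := occupancy_biUnion_le _ _ hcover
  rw [Finset.sum_Ico_succ_top haj] at hle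
  have h1 : ∑ m ∈ Finset.Ico a j, occupancy (σ.runSet (k, m)) s e ≤ ((j : ℝ) - a) * τ.C k := by
    refine (Finset.sum_le_card_nsmul _ _ (τ.C k) fun m _ =>
      (h.occupancy_runSet_le k m h0 e).trans (ω.exec_le k m)).trans ?_
    simp [Nat.cast_sub haj]
  have h2 : occupancy (σ.runSet (k, j)) s e < τ.C k :=
    ((occupancy_mono_left h0).trans_lt hmiss).trans_le (ω.exec_le k j)
  have h3 := arrival_add_mul_le ω k haj
  have hja : (0 : ℝ) ≤ (j : ℝ) - a := sub_nonneg.2 (Nat.cast_le.2 haj)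
  -- Each earlier job is charged to one period, the late job to the relative deadline; density
  -- covers both. Strictness comes from the late job.
  have h4 := mul_le_mul_of_nonneg_left (τ.le_density_mul_period k) hja
  have h5 := τ.le_density_mul_deadline k
  have h6 : τ.density k * (((j : ℝ) - a) * τ.T k) ≤ τ.density k * (ω.arrival k j - s) :=
    mul_le_mul_of_nonneg_left (by linarith) (τ.density_pos k).le
  have h7 : τ.density k * (e - s) = τ.density k * (ω.arrival k j - s) + τ.density k * τ.D k := by
    rw [he]; ring
  nlinarith

/-- While task `i` is active but not executed, all processors execute tasks of higher priority. -/
theorem IsGlobalFP.le_sum_occupancy (h : σ.IsGlobalFP ω) {i : Fin N} {s e : ℝ} (hse : s ≤ e)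
    (hact : ∀ x ∈ Set.Ico s e, σ.Active ω i x) :
    (M : ℝ) * (e - s) ≤ ∑ i' ∈ Finset.Iio i, occupancy (σ.taskRunSet i') s e
      + M * occupancy (σ.taskRunSet i) s e := by
  classical
  have hint : ∀ i', IntegrableOn ((σ.taskRunSet i').indicator (fun _ => (1 : ℝ))) (Set.Ico s e) :=
    fun i' => (integrableOn_const (by simp) (by simp)).indicator
      (h.measurableSet_taskRunSet i')
  have hpt : ∀ x ∈ Set.Ico s e, (M : ℝ) ≤
      ∑ i' ∈ Finset.Iio i, (σ.taskRunSet i').indicator (fun _ => (1 : ℝ)) x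
        + M * (σ.taskRunSet i).indicator (fun _ => (1 : ℝ)) x := by
    intro x hx
    have hnn : ∀ i', 0 ≤ (σ.taskRunSet i').indicator (fun _ => (1 : ℝ)) x :=
      fun i' => Set.indicator_nonneg (fun _ _ => zero_le_one) x
    by_cases hrun : x ∈ σ.taskRunSet i
    · simpa [Set.indicator_of_mem hrun] using Finset.sum_nonneg fun i' _ => hnn i'
    · have hprio := h.priority x i (hact x hx) fun p j hp =>
        hrun (Set.mem_iUnion.2 ⟨j, p, hp⟩)
      choose f g hfi hfg using hprio
      -- Without intra-task parallelism, the `M` processors serve `M` distinct tasks.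
      have hinj : Function.Injective f := fun p q hpq =>
        h.sequential p q x (f p) (g p) (g q) (hfg p) (by rw [hpq]; exact hfg q)
      have himg : Finset.univ.image f ⊆ Finset.Iio i := by
        intro i' hi'
        obtain ⟨p, -, rfl⟩ := Finset.mem_image.1 hi'
        exact Finset.mem_Iio.2 (hfi p)
      have hsum := Finset.sum_le_sum_of_subset_of_nonneg
        (f := fun i' => (σ.taskRunSet i').indicator (fun _ => (1 : ℝ)) x) himg
        fun i' _ _ => hnn i'
      rw [Finset.sum_image hinj.injOn, Finset.sum_congr rfl fun p _ =>
        Set.indicator_of_mem (s := σ.taskRunSet (f p)) (Set.mem_iUnion.2 ⟨g p, p, hfg p⟩) _] at hsum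
      simp only [Finset.sum_const, Finset.card_univ, Fintype.card_fin, nsmul_eq_mul,
        mul_one] at hsum
      rw [Set.indicator_of_notMem hrun]
      linarith
  have hmono := setIntegral_mono_on (μ := volume) (s := Set.Ico s e) (f := fun _ => (M : ℝ))
    (integrableOn_const (by simp) (by simp))
    ((integrable_finsetSum (Finset.Iio i) fun i' _ => hint i').add ((hint i).const_mul (M : ℝ)))
    measurableSet_Ico hpt
  rw [integral_add' (integrable_finsetSum (Finset.Iio i) fun i' _ => hint i')
    ((hint i).const_mul (M : ℝ)), integral_finsetSum _ fun i' _ => hint i',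
    integral_const_mul] at hmono
  simp only [← occupancy_eq_integral (h.measurableSet_taskRunSet _)] at hmono
  simpa [Real.volume_real_Ico_of_le hse, mul_comm] using hmono

end Schedule

/-! ### The contradiction from a missed deadline -/

/-- The test is sufficient. -/
theorem TaskSystem.PassesTest.schedulable {N M : ℕ} {τ : TaskSystem N} {k : Fin N} (hM : 2 ≤ M)
    (htest : τ.PassesTest M k) : τ.Schedulable M k := by
  classical
  intro ω σ h j
  by_contra! hmiss
  set e := ω.arrival k j + τ.D k with he
  have hM' : (2 : ℝ) ≤ M := by exact_mod_cast hM
  set ρ := τ.maxUtilDensity k with hρ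
  set μ : ℝ := M - (M - 1) * ρ with hμ
  have hD := τ.D_pos k
  obtain ⟨s, hs0, hsj, hclean, hact⟩ := Schedule.exists_clean σ ω k
    (Schedule.zero_le_arrival ω k j)
  have hse : s ≤ e := by linarith
  have hX := hclean.occupancy_lt_of_miss h hs0 hsj hmiss
  rw [← he] at hX
  set X := occupancy (σ.taskRunSet k) s e
  have hactive : ∀ x ∈ Set.Ico s e, σ.Active ω k x := by
    intro x hx
    by_cases hxj : x < ω.arrival k j
    · exact hact x ⟨hx.1, hxj⟩
    · exact ⟨j, not_lt.1 hxj, (σ.service_mono (k, j) hx.2.le).trans_lt hmiss⟩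
  have hbusy := h.le_sum_occupancy hse hactive
  have hadd : ∀ (i : Fin N) {a b : ℝ}, 0 ≤ a → a ≤ b → occupancy (σ.taskRunSet i) a b =
      occupancy (σ.taskRunSet i) 0 b - occupancy (σ.taskRunSet i) 0 a := fun i a b h₁ h₂ => by
    rw [occupancy_add (h.measurableSet_taskRunSet i) h₁ h₂]; ring
  -- Minimality is used against earlier points to bound carry-in, and against `s` to bound the work
  -- in `[t₀, s)` from below.
  obtain ⟨t₀, ht₀, hmin⟩ := isCompact_Icc.exists_isMinOn (s := Set.Icc 0 s)
    (f := fun t => ∑ i ∈ Finset.Iio k, occupancy (σ.taskRunSet i) 0 t - μ * t)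
    (Set.nonempty_Icc.2 hs0) (by
      refine ContinuousOn.sub (continuousOn_finsetSum _ fun i _ => ?_) (by fun_prop)
      exact (continuousOn_occupancy _ (h.measurableSet_taskRunSet i)).mono Set.Icc_subset_Ici_self)
  have hgain : ∀ t ∈ Set.Icc 0 s, ∑ i ∈ Finset.Iio k, occupancy (σ.taskRunSet i) 0 t₀ - μ * t₀
      ≤ ∑ i ∈ Finset.Iio k, occupancy (σ.taskRunSet i) 0 t - μ * t := fun t ht => hmin ht
  have ht₀e : t₀ ≤ e := ht₀.2.trans hse
  have hwork : ∀ i ∈ Finset.Iio k, occupancy (σ.taskRunSet i) t₀ e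
      ≤ τ.util i * (e - t₀) + τ.C i * (1 - τ.util i) := by
    intro i hi
    have hik := Finset.mem_Iio.1 hi
    obtain ⟨r, hr0, hrt, hrclean, hract⟩ := Schedule.exists_clean σ ω i ht₀.1
    have h1 := hrclean.occupancy_le h hr0 (hrt.trans ht₀e)
    rw [occupancy_add (h.measurableSet_taskRunSet i) hrt ht₀e] at h1
    have h2 := h.le_sum_occupancy hrt hract
    have h3 := hgain r ⟨hr0, hrt.trans ht₀.2⟩
    have h4 : ∑ i' ∈ Finset.Iio i, occupancy (σ.taskRunSet i') r t₀
        + occupancy (σ.taskRunSet i) r t₀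
        ≤ ∑ i' ∈ Finset.Iio k, occupancy (σ.taskRunSet i') r t₀ := by
      rw [add_comm, ← Finset.sum_insert (f := fun i' => occupancy (σ.taskRunSet i') r t₀)
        (a := i) (s := Finset.Iio i) (by simp)]
      refine Finset.sum_le_sum_of_subset_of_nonneg (fun i' hi' => ?_)
        fun _ _ _ => occupancy_nonneg _ _ _
      rcases Finset.mem_insert.1 hi' with rfl | hi'
      · exact hi
      · exact Finset.mem_Iio.2 ((Finset.mem_Iio.1 hi').trans hik)
    have h5 : ∑ i' ∈ Finset.Iio k, occupancy (σ.taskRunSet i') r t₀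
        = ∑ i' ∈ Finset.Iio k, occupancy (σ.taskRunSet i') 0 t₀
          - ∑ i' ∈ Finset.Iio k, occupancy (σ.taskRunSet i') 0 r := by
      rw [← Finset.sum_sub_distrib]
      exact Finset.sum_congr rfl fun i' _ => hadd i' hr0 hrt
    -- Moving one copy of the execution of task `i` into the higher-priority sum leaves `M - 1`
    -- copies, which matches the factor of `ρ` in `μ`.
    have h6 : ρ * (t₀ - r) ≤ occupancy (σ.taskRunSet i) r t₀ := by
      have : ((M : ℝ) - 1) * (ρ * (t₀ - r)) ≤ (M - 1) * occupancy (σ.taskRunSet i) r t₀ := by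
        rw [hμ] at h3; nlinarith
      exact le_of_mul_le_mul_left this (by linarith)
    have h7 := mul_le_mul_of_nonneg_right (τ.util_le_maxUtilDensity hik) (sub_nonneg.2 hrt)
    rw [← hρ] at h7
    linarith
  have hsum := Finset.sum_le_sum hwork
  have hg := hgain s ⟨hs0, le_rfl⟩
  have e1 : ∑ i ∈ Finset.Iio k, occupancy (σ.taskRunSet i) t₀ e
      = ∑ i ∈ Finset.Iio k, occupancy (σ.taskRunSet i) 0 e
        - ∑ i ∈ Finset.Iio k, occupancy (σ.taskRunSet i) 0 t₀ := by
    rw [← Finset.sum_sub_distrib]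
    exact Finset.sum_congr rfl fun i _ => hadd i ht₀.1 ht₀e
  have e2 : ∑ i ∈ Finset.Iio k, occupancy (σ.taskRunSet i) s e
      = ∑ i ∈ Finset.Iio k, occupancy (σ.taskRunSet i) 0 e
        - ∑ i ∈ Finset.Iio k, occupancy (σ.taskRunSet i) 0 s := by
    rw [← Finset.sum_sub_distrib]
    exact Finset.sum_congr rfl fun i _ => hadd i hs0 hse
  have hL : τ.D k ≤ e - t₀ := by linarith [ht₀.2]
  have hL0 : 0 < e - t₀ := by linarith
  have hδ := τ.density_pos k
  have hδρ := τ.density_le_maxUtilDensity k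
  rw [← hρ] at hδρ
  have hXρ : ((M : ℝ) - 1) * X ≤ (M - 1) * (ρ * (e - s)) := by
    refine mul_le_mul_of_nonneg_left (hX.le.trans ?_) (by linarith)
    exact mul_le_mul_of_nonneg_right hδρ (by linarith)
  have hXδ : X < τ.density k * (e - t₀) :=
    hX.trans_le (mul_le_mul_of_nonneg_left (by linarith [ht₀.2]) hδ.le)
  have hlow : μ * (e - t₀) < ∑ i ∈ Finset.Iio k,
      (τ.util i * (e - t₀) + τ.C i * (1 - τ.util i)) + τ.density k * (e - t₀) := by
    -- Of the `M` copies of `X` in `hbusy`, one is kept and `M - 1` are bounded through `ρ`.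
    have : μ * (e - s) ≤ ∑ i ∈ Finset.Iio k, occupancy (σ.taskRunSet i) s e + X := by
      rw [hμ]; nlinarith
    nlinarith
  have hterm : ∑ i ∈ Finset.Iio k, (τ.util i * (e - t₀) + τ.C i * (1 - τ.util i))
      ≤ (∑ i ∈ Finset.Iio k, ((τ.C i - τ.C i * τ.util i) / τ.D k + τ.util i)) * (e - t₀) := by
    rw [Finset.sum_mul]
    refine Finset.sum_le_sum fun i _ => ?_
    have hc : 0 ≤ τ.C i - τ.C i * τ.util i := by
      nlinarith [τ.C_pos i, τ.util_le_one i]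
    have : τ.C i - τ.C i * τ.util i ≤ (τ.C i - τ.C i * τ.util i) / τ.D k * (e - t₀) := by
      rw [div_mul_eq_mul_div, le_div_iff₀ hD]
      exact mul_le_mul_of_nonneg_left hL hc
    linarith
  have hfinal := mul_le_mul_of_nonneg_right htest hL0.le
  rw [← hρ, ← hμ, add_mul] at hfinal
  linarith

/-! ### The linear-time program -/

namespace RealRAM

/-- From configuration `s`, `P` reaches within `n` steps a configuration satisfying `Q`. -/
def ReachesWithin (P : Program) (n : ℕ) (s : Config) (Q : Config → Prop) : Prop :=
  ∃ m ≤ n, Q ((step P)^[m] s)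

theorem ReachesWithin.bind {P : Program} {m n : ℕ} {s : Config} {Q Q' : Config → Prop}
    (h₁ : ReachesWithin P m s Q) (h₂ : ∀ s', Q s' → ReachesWithin P n s' Q') :
    ReachesWithin P (m + n) s Q' := by
  obtain ⟨a, ha, hQ⟩ := h₁
  obtain ⟨b, hb, hQ'⟩ := h₂ _ hQ
  exact ⟨b + a, by omega, by rwa [Function.iterate_add_apply]⟩

theorem ReachesWithin.mono {P : Program} {m n : ℕ} {s : Config} {Q : Config → Prop}
    (h : ReachesWithin P m s Q) (hmn : m ≤ n) : ReachesWithin P n s Q := by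
  obtain ⟨a, ha, hQ⟩ := h
  exact ⟨a, ha.trans hmn, hQ⟩

theorem ReachesWithin.refl {P : Program} {n : ℕ} {s : Config} {Q : Config → Prop} (h : Q s) :
    ReachesWithin P n s Q := ⟨0, Nat.zero_le n, h⟩

/-- The configuration is written out in fields so that, at a literal program counter, the
instruction lookup holds by `rfl`. -/
theorem ReachesWithin.head {P : Program} {n pc : ℕ} {reg : ℕ → ℝ} {idx : ℕ → ℕ} {mem : ℕ → ℝ}
    {Q : Config → Prop} {ins : Instr} (hins : P[pc]? = some ins)
    (h : ReachesWithin P n (ins.exec ⟨pc, reg, idx, mem, none⟩) Q) :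
    ReachesWithin P (n + 1) ⟨pc, reg, idx, mem, none⟩ Q := by
  obtain ⟨m, hm, hQ⟩ := h
  refine ⟨m + 1, by omega, ?_⟩
  rw [Function.iterate_succ_apply]
  simpa [step, hins] using hQ

/-- The program of the linear-time test. Index register `1` counts the tasks, index register `2`
points to the memory; real registers `5`, `6`, `7` accumulate `∑ (C i - C i * U i)`, `∑ U i` and
`max U i`. -/
def testProgram : Program :=
  [.iconst 3 1,
   .ijle 0 1 16,
   .iadd 2 2 3,
   .load 1 2,
   .iadd 2 2 3,
   .iadd 2 2 3,
   .load 2 2,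
   .arith .div 3 1 2,
   .arith .mul 4 1 3,
   .arith .sub 4 1 4,
   .arith .add 5 5 4,
   .arith .add 6 6 3,
   .jle 3 7 14,
   -- Real register `0` is never written and stays zero, so adding it copies a register; `.ijle 0 0`
   -- is an unconditional jump.
   .arith .add 7 3 0,
   .iadd 1 1 3,
   .ijle 0 0 1,
   .iadd 2 2 3,
   .load 1 2,
   .iadd 2 2 3,
   .load 2 2,
   .iadd 2 2 3,
   .load 3 2,
   .arith .add 8 2 0,
   .jle 2 3 25,
   .arith .add 8 3 0,
   .arith .div 8 1 8,
   .jle 8 7 28,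
   .arith .add 7 8 0,
   .arith .div 5 5 2,
   .arith .add 5 5 6,
   .arith .add 5 5 8,
   .iconst 4 0,
   .load 9 4,
   .const 10 1,
   .arith .sub 11 9 10,
   .arith .mul 11 11 7,
   .arith .sub 11 9 11,
   .jle 5 11 39,
   .halt false,
   .halt true]

/-- The configuration at the head of the loop, after `i` of `n` tasks, with accumulators
`A`, `B`, `m`. -/
structure LoopState (n i : ℕ) (A B m : ℝ) (x : ℕ → ℝ) (s : Config) : Prop where
  pc : s.pc = 1
  reg0 : s.reg 0 = 0
  reg5 : s.reg 5 = A
  reg6 : s.reg 6 = B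
  reg7 : s.reg 7 = m
  idx0 : s.idx 0 = n
  idx1 : s.idx 1 = i
  idx2 : s.idx 2 = 3 * i
  idx3 : s.idx 3 = 1
  mem : s.mem = x
  out : s.out = none

theorem reaches_loopState_zero (n : ℕ) (x : ℕ → ℝ) :
    ReachesWithin testProgram 1 (init n x) (LoopState n 0 0 0 0 x) := by
  refine .head rfl (.refl ?_)
  constructor <;> simp [Instr.exec]

/-- Twelve instructions lead through the comparison with the running maximum, and at most three
follow. The deadline cell is skipped. -/
theorem LoopState.reaches_succ {n i : ℕ} {A B m : ℝ} {x : ℕ → ℝ} {s : Config} (hi : i < n)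
    (h : LoopState n i A B m x s) :
    ReachesWithin testProgram 15 s (LoopState n (i + 1)
        (A + (x (3 * i + 1) - x (3 * i + 1) * (x (3 * i + 1) / x (3 * i + 3))))
        (B + x (3 * i + 1) / x (3 * i + 3))
        (max (x (3 * i + 1) / x (3 * i + 3)) m) x) := by
  obtain ⟨pc, reg, idx, mem, out⟩ := s
  obtain ⟨h1, h2, h3, h4, h5, h6, h7, h8, h9, h10, h11⟩ := h
  dsimp only at h1 h2 h3 h4 h5 h6 h7 h8 h9 h10 h11
  subst h1 h10 h11
  iterate 12
    refine .head rfl ?_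
    simp only [Instr.exec, Op.eval, ne_eq, Nat.reduceEqDiff, not_false_eq_true,
      Function.update_self, Function.update_of_ne, Nat.reduceAdd, OfNat.ofNat_ne_one,
      OfNat.one_ne_ofNat, add_assoc (3 * i), h3, h4, h5, h6, h7, h8, h9, not_le.2 hi, if_false]
  by_cases hle : mem (3 * i + 1) / mem (3 * i + 3) ≤ m
  · rw [if_pos hle]
    iterate 2 refine .head rfl ?_
    refine .refl ?_
    constructor <;> simp [Instr.exec, mul_add, *]
  · rw [if_neg hle]
    iterate 3 refine .head rfl ?_
    refine .refl ?_
    constructor <;> simp [Instr.exec, Op.eval, mul_add, (not_le.1 hle).le, *]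

theorem reaches_loopState (n : ℕ) (x : ℕ → ℝ) {i : ℕ} (hi : i ≤ n) :
    ReachesWithin testProgram (1 + 15 * i) (init n x) (LoopState n i
      (∑ j ∈ Finset.range i, (x (3 * j + 1) - x (3 * j + 1) * (x (3 * j + 1) / x (3 * j + 3))))
      (∑ j ∈ Finset.range i, x (3 * j + 1) / x (3 * j + 3))
      ((Finset.range i).fold max 0 fun j => x (3 * j + 1) / x (3 * j + 3)) x) := by
  induction i with
  | zero => simpa using reaches_loopState_zero n x
  | succ i ih =>
    have := (ih (by omega)).bind fun s' hs' => hs'.reaches_succ (by omega)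
    simp only [Finset.sum_range_succ]
    rw [Finset.range_add_one, Finset.fold_insert Finset.notMem_range_self]
    exact this

theorem LoopState.reaches_halt {n : ℕ} {A B m : ℝ} {x : ℕ → ℝ} {s : Config}
    (h : LoopState n n A B m x s) :
    ReachesWithin testProgram 25 s fun s' => ∃ b : Bool, s'.out = some b ∧ (b = true ↔
      A / x (3 * n + 2) + B + x (3 * n + 1) / min (x (3 * n + 2)) (x (3 * n + 3)) ≤
        x 0 - (x 0 - 1) *
          max (x (3 * n + 1) / min (x (3 * n + 2)) (x (3 * n + 3))) m) := by
  obtain ⟨pc, reg, idx, mem, out⟩ := s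
  obtain ⟨h1, h2, h3, h4, h5, h6, h7, h8, h9, h10, h11⟩ := h
  dsimp only at h1 h2 h3 h4 h5 h6 h7 h8 h9 h10 h11
  subst h1 h10 h11
  set δ := mem (3 * n + 1) / min (mem (3 * n + 2)) (mem (3 * n + 3)) with hδ
  -- The code after each join point is treated for arbitrary registers, so that both branches of the
  -- preceding jump can continue with it.
  have compare : ∀ (reg : ℕ → ℝ) (idx : ℕ → ℕ) (ρ : ℝ), reg 2 = mem (3 * n + 2) → reg 5 = A →
      reg 6 = B → reg 7 = ρ → reg 8 = δ →
      ReachesWithin testProgram 11 ⟨28, reg, idx, mem, none⟩ fun s' => ∃ b : Bool,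
        s'.out = some b ∧
          (b = true ↔ A / mem (3 * n + 2) + B + δ ≤ mem 0 - (mem 0 - 1) * ρ) := by
    intro reg idx ρ g2 g5 g6 g7 g8
    iterate 10
      refine .head rfl ?_
      simp only [Instr.exec, Op.eval, ne_eq, Nat.reduceEqDiff, not_false_eq_true,
        Function.update_self, Function.update_of_ne, Nat.reduceAdd,
        g2, g5, g6, g7, g8, Nat.cast_one]
    by_cases hle : A / mem (3 * n + 2) + B + δ ≤ mem 0 - (mem 0 - 1) * ρ
    · rw [if_pos hle]
      exact .head rfl (.refl ⟨true, rfl, by simpa using hle⟩)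
    · rw [if_neg hle]
      exact .head rfl (.refl ⟨false, rfl, by simpa using hle⟩)
  have maximum : ∀ (reg : ℕ → ℝ) (idx : ℕ → ℕ), reg 0 = 0 → reg 1 = mem (3 * n + 1) →
      reg 2 = mem (3 * n + 2) → reg 5 = A → reg 6 = B → reg 7 = m →
      reg 8 = min (mem (3 * n + 2)) (mem (3 * n + 3)) →
      ReachesWithin testProgram 14 ⟨25, reg, idx, mem, none⟩ fun s' => ∃ b : Bool,
        s'.out = some b ∧
          (b = true ↔ A / mem (3 * n + 2) + B + δ ≤ mem 0 - (mem 0 - 1) * max δ m) := by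
    intro reg idx g0 g1 g2 g5 g6 g7 g8
    iterate 2
      refine .head rfl ?_
      simp only [Instr.exec, Op.eval, ne_eq, Nat.reduceEqDiff, not_false_eq_true,
        Function.update_self, Function.update_of_ne, Nat.reduceAdd,
        g1, g7, g8, ← hδ]
    by_cases hle : δ ≤ m
    · rw [if_pos hle]
      refine (compare _ _ _ ?_ ?_ ?_ ?_ ?_).mono (by norm_num) <;> simp [g2, g5, g6, g7, hle]
    · rw [if_neg hle]
      refine .head rfl (compare _ _ _ ?_ ?_ ?_ ?_ ?_) <;>
        simp [Op.eval, g0, g2, g5, g6, (not_le.1 hle).le]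
  iterate 9
    refine .head rfl ?_
    simp only [Instr.exec, Op.eval, ne_eq, Nat.reduceEqDiff, not_false_eq_true,
      Function.update_self, Function.update_of_ne, Nat.reduceAdd,
      OfNat.zero_ne_ofNat, zero_ne_one, add_assoc (3 * n), h2, h6, h7, h8, h9, le_refl, if_true]
  by_cases hle : mem (3 * n + 2) ≤ mem (3 * n + 3)
  · rw [if_pos hle]
    refine (maximum _ _ ?_ ?_ ?_ ?_ ?_ ?_ ?_).mono (by norm_num) <;> simp [*]
  · rw [if_neg hle]
    refine .head rfl ?_
    refine (maximum _ _ ?_ ?_ ?_ ?_ ?_ ?_ ?_).mono (by norm_num) <;>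
      simp [Op.eval, (not_le.1 hle).le, *]

theorem decidesWithin_testProgram (n : ℕ) (x : ℕ → ℝ) :
    DecidesWithin testProgram n x (26 * (n + 1))
      ((∑ j ∈ Finset.range n,
            (x (3 * j + 1) - x (3 * j + 1) * (x (3 * j + 1) / x (3 * j + 3)))) / x (3 * n + 2)
          + ∑ j ∈ Finset.range n, x (3 * j + 1) / x (3 * j + 3)
          + x (3 * n + 1) / min (x (3 * n + 2)) (x (3 * n + 3)) ≤
        x 0 - (x 0 - 1) * max (x (3 * n + 1) / min (x (3 * n + 2)) (x (3 * n + 3)))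
          ((Finset.range n).fold max 0 fun j => x (3 * j + 1) / x (3 * j + 3))) := by
  obtain ⟨t, ht, b, hb, hiff⟩ :=
    (reaches_loopState n x le_rfl).bind fun s hs => hs.reaches_halt
  exact ⟨t, by omega, b, hb, hiff⟩

end RealRAM

/-! ### The program applied to a task system -/

namespace TaskSystem

variable {N : ℕ} (τ : TaskSystem N) (M : ℕ) (i : Fin N)

theorem input_C : τ.input M (3 * (i : ℕ) + 1) = τ.C i := by
  have h1 : 3 * (i : ℕ) / 3 = i := by omega
  simp [input, h1]

theorem input_D : τ.input M (3 * (i : ℕ) + 2) = τ.D i := by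
  have h1 : (3 * (i : ℕ) + 1) / 3 = i := by omega
  have h2 : (3 * (i : ℕ) + 1) % 3 = 1 := by omega
  simp [input, h1, h2]

theorem input_T : τ.input M (3 * (i : ℕ) + 3) = τ.T i := by
  have h1 : (3 * (i : ℕ) + 2) / 3 = i := by omega
  have h2 : (3 * (i : ℕ) + 2) % 3 = 2 := by omega
  simp [input, h1, h2]

/-- The program starts its maximum at `0`, as `δ_k` is computed only after the loop; nonnegativity
of `δ_k` makes this harmless. -/
theorem max_fold_util {k : Fin N} (h : 0 ≤ τ.density k) :
    max (τ.density k) ((Finset.Iio k).fold max 0 τ.util) = τ.maxUtilDensity k := by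
  unfold maxUtilDensity
  apply le_antisymm
  · refine max_le ((Finset.le_fold_max _).2 (Or.inl le_rfl)) (Finset.fold_max_le _ |>.2 ⟨?_, ?_⟩)
    · exact (Finset.le_fold_max _).2 (Or.inl h)
    · exact fun i hi => (Finset.le_fold_max _).2 (Or.inr ⟨i, hi, le_rfl⟩)
  · refine (Finset.fold_max_le _).2 ⟨le_max_left _ _, fun i hi => le_max_of_le_right ?_⟩
    exact (Finset.le_fold_max _).2 (Or.inr ⟨i, hi, le_rfl⟩)

theorem decidesWithin_passesTest (k : Fin N) :
    RealRAM.DecidesWithin RealRAM.testProgram k (τ.input M) (26 * ((k : ℕ) + 1))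
      (τ.PassesTest M k) := by
  have h := RealRAM.decidesWithin_testProgram k (τ.input M)
  have hrange : Finset.range (k : ℕ) = (Finset.Iio k).map Fin.valEmbedding := by
    rw [Fin.map_valEmbedding_Iio, Nat.Iio_eq_range]
  have hδ : 0 ≤ τ.C k / min (τ.D k) (τ.T k) :=
    (div_pos (τ.C_pos k) (lt_min (τ.D_pos k) (τ.T_pos k))).le
  rw [hrange, Finset.sum_map, Finset.sum_map, Finset.fold_map] at h
  simp only [Fin.valEmbedding_apply, Function.comp_def, input_C, input_D, input_T] at h
  convert h using 1
  unfold PassesTest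
  rw [← τ.max_fold_util hδ, Finset.sum_add_distrib, ← Finset.sum_div, add_comm]
  rfl

end TaskSystem

theorem theorem4p7 :
    -- the test is sufficient
    (∀ (N M : ℕ) (τ : TaskSystem N) (k : Fin N), 2 ≤ M →
      τ.PassesTest M k → τ.Schedulable M k) ∧
    -- one fixed program performs the test in a number of steps linear in the number of tasks
    -- of priority at least that of task `k`
    (∃ (P : RealRAM.Program) (c : ℕ), ∀ (N M : ℕ) (τ : TaskSystem N) (k : Fin N), 2 ≤ M →
      RealRAM.DecidesWithin P (k : ℕ) (τ.input M) (c * ((k : ℕ) + 1)) (τ.PassesTest M k)) := by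
  exact ⟨fun _ _ _ _ hM htest => htest.schedulable hM,
    RealRAM.testProgram, 26, fun _ M τ k _ => τ.decidesWithin_passesTest M k⟩
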